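/- All $C^*$-algebras and $*$-homomorphisms are over $\mathbb{C}$. For a unital $C^*$-algebra $\mathcal{A}$ write $\mathcal{A}_\infty = \ell^\infty(\mathbb{N},\mathcal{A})/C_0(\mathbb{N},\mathcal{A})$, where $C_0(\mathbb{N},\mathcal{A})$ is the ideal of sequences converging to $0$ in norm; view $\mathcal{A}$ inside $\ell^\infty(\mathbb{N},\mathcal{A})$ and $\mathcal{A}_\infty$ as (classes of) constant sequences, and let $\mathcal{A}_\infty\cap\mathcal{A}'$ be the relative commutant of $\mathcal{A}$ in $\mathcal{A}_\infty$ (the central sequence algebra). An action $\alpha$ of a group $G$ on $\mathcal{A}$ by $*$-automorphisms induces, termwise, actions $\bar\alpha$ of $G$ on $\ell^\infty(\mathbb{N},\mathcal{A})$, $\mathcal{A}_\infty$ and $\mathcal{A}_\infty\cap\mathcal{A}'$. When $G$ is a topological group, let $\ell^{\infty,(\alpha)}(\mathbb{N},\mathcal{A})$ be the set of $x\in\ell^\infty(\mathbb{N},\mathcal{A})$ for which $g\mapsto\bar\alpha_g(x)$ is norm continuous, and let $\mathcal{A}_\infty^{(\alpha)}\subseteq\mathcal{A}_\infty$ be its image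 in $\mathcal{A}_\infty$. An embedding is an injective $*$-homomorphism. A strongly continuous action $\alpha$ (i.e. $g\mapsto\alpha_g(a)$ is norm continuous for each $a\in\mathcal{A}$) of a compact Hausdorff second countable group $G$ on a separable unital $C^*$-algebra $\mathcal{A}$ has the Rokhlin property if there is a unital embedding $\theta: C(G)\to\mathcal{A}_\infty^{(\alpha)}\cap\mathcal{A}'$ such that $\bar\alpha_g(\theta(f))=\theta\big(h\mapsto f(g^{-1}h)\big)$ for all $f\in C(G)$ and $g\in G$. **Theorem.** Let $\mathcal{A}$ be a separable unital $C^*$-algebra, let $G$ be a compact Hausdorff second countable group, and let $\alpha:G\to\mathrm{Aut}(\mathcal{A})$ be a strongly continuous action with the Rokhlin property. Let $\mathcal{B}$ be a separable unital $C^*$-algebra which admits a central sequence of unital embeddings into $\mathcal{A}$, i.e. there are unital embeddings $\psi_n:\mathcal{B}\to\mathcal{A}$, $n\in\mathbb{N}$, with $\|\psi_n(b)a-a\psi_n(b)\|\to 0$ for all $b\in\mathcal{B}$ and $a\in\mathcal{A}$. Then there is a unital embedding of $\mathcal{B}$ into the fixed point subalgebra $\{x\in\mathcal{A}_\infty\cap\mathcal{A}'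 : \bar\alpha_g(x)=x \text{ for all } g\in G\}$. -/

import Mathlib

open Filter Topology BoundedContinuousFunction

noncomputable section

namespace CentralSeq

universe u v

/-- `ℓ^∞(ℕ, A)`: the C⋆-algebra of bounded sequences in `A`, realised as the bounded (automatically
continuous) functions on the discrete space `ℕ`, with the pointwise operations and sup norm. -/
abbrev EllInfty (A : Type u) [CStarAlgebra A] : Type u := ℕ →ᵇ A

/-- `C₀(ℕ, A)`: the ideal of `ℓ^∞(ℕ, A)` of sequences converging to zero in norm. -/
def cZero (A : Type u) [CStarAlgebra A] : Ideal (EllInfty A) where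
  carrier := {x | Tendsto (fun n => ‖x n‖) atTop (𝓝 0)}
  zero_mem' := by simp
  add_mem' := by
    intro x y hx hy
    have h := Tendsto.add hx hy
    rw [add_zero] at h
    exact squeeze_zero (fun n => norm_nonneg _) (fun n => norm_add_le (x n) (y n)) h
  smul_mem' := by
    intro c x hx
    have h := Tendsto.const_mul ‖c‖ hx
    rw [mul_zero] at h
    refine squeeze_zero (fun n => norm_nonneg _) (fun n => ?_) h
    exact (norm_mul_le (c n) (x n)).trans
      (mul_le_mul_of_nonneg_right (c.norm_coe_le_norm n) (norm_nonneg _))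

theorem mem_cZero {A : Type u} [CStarAlgebra A] {x : EllInfty A} :
    x ∈ cZero A ↔ Tendsto (fun n => ‖x n‖) atTop (𝓝 0) := Iff.rfl

instance cZero_isTwoSided (A : Type u) [CStarAlgebra A] : (cZero A).IsTwoSided where
  mul_mem_of_left := by
    intro x c hx
    have h := Tendsto.mul_const ‖c‖ (mem_cZero.1 hx)
    rw [zero_mul] at h
    refine squeeze_zero (fun n => norm_nonneg _) (fun n => ?_) h
    exact (norm_mul_le (x n) (c n)).trans
      (mul_le_mul_of_nonneg_left (c.norm_coe_le_norm n) (norm_nonneg _))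

theorem star_mem_cZero {A : Type u} [CStarAlgebra A] {x : EllInfty A} (hx : x ∈ cZero A) :
    star x ∈ cZero A := by
  rw [mem_cZero] at hx ⊢
  simpa using hx

/-- The sequence algebra `A_∞ = ℓ^∞(ℕ, A) / C₀(ℕ, A)`. -/
abbrev AInfty (A : Type u) [CStarAlgebra A] : Type u := EllInfty A ⧸ cZero A

/-- The quotient map `ℓ^∞(ℕ, A) → A_∞` as a ring homomorphism. -/
abbrev mkRingHom (A : Type u) [CStarAlgebra A] : EllInfty A →+* AInfty A :=
  Ideal.Quotient.mk (cZero A)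

/-- The involution of `A_∞`, induced from `ℓ^∞(ℕ, A)`. -/
instance instStarAInfty (A : Type u) [CStarAlgebra A] : Star (AInfty A) where
  star := Quotient.lift (fun x => mkRingHom A (star x)) (by
    intro x y hxy
    have h : x - y ∈ cZero A := (Submodule.quotientRel_def _).1 hxy
    refine Ideal.Quotient.eq.2 ?_
    rw [← star_sub]
    exact star_mem_cZero h)

theorem star_mk {A : Type u} [CStarAlgebra A] (x : EllInfty A) :
    star (mkRingHom A x) = mkRingHom A (star x) := rfl

instance instStarRingAInfty (A : Type u) [CStarAlgebra A] : StarRing (AInfty A) where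
  star_involutive := by
    intro x
    obtain ⟨x, rfl⟩ := Ideal.Quotient.mk_surjective x
    rw [star_mk, star_mk, star_star]
  star_mul := by
    intro x y
    obtain ⟨x, rfl⟩ := Ideal.Quotient.mk_surjective x
    obtain ⟨y, rfl⟩ := Ideal.Quotient.mk_surjective y
    rw [← map_mul, star_mk, star_mk, star_mk, star_mul, map_mul]
  star_add := by
    intro x y
    obtain ⟨x, rfl⟩ := Ideal.Quotient.mk_surjective x
    obtain ⟨y, rfl⟩ := Ideal.Quotient.mk_surjective y
    rw [← map_add, star_mk, star_mk, star_mk, star_add, map_add]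

theorem smul_mk {A : Type u} [CStarAlgebra A] (c : ℂ) (x : EllInfty A) :
    c • mkRingHom A x = mkRingHom A (c • x) := rfl

instance instStarModuleAInfty (A : Type u) [CStarAlgebra A] : StarModule ℂ (AInfty A) where
  star_smul := by
    intro c x
    obtain ⟨x, rfl⟩ := Ideal.Quotient.mk_surjective x
    rw [smul_mk, star_mk, star_mk, smul_mk, star_smul]

/-- The quotient map `π : ℓ^∞(ℕ, A) → A_∞` as a unital ⋆-homomorphism. -/
def proj (A : Type u) [CStarAlgebra A] : EllInfty A →⋆ₐ[ℂ] AInfty A where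
  toRingHom := mkRingHom A
  commutes' := fun _ => rfl
  map_star' := fun _ => rfl

/-- The embedding of `A` into `ℓ^∞(ℕ, A)` as constant sequences. -/
def constSeq (A : Type u) [CStarAlgebra A] : A →⋆ₐ[ℂ] EllInfty A where
  toFun a := BoundedContinuousFunction.const ℕ a
  map_one' := rfl
  map_mul' _ _ := rfl
  map_zero' := rfl
  map_add' _ _ := rfl
  commutes' _ := rfl
  map_star' _ := rfl

/-- The canonical embedding `ι_A` of `A` into `A_∞`. -/
def iota (A : Type u) [CStarAlgebra A] : A →⋆ₐ[ℂ] AInfty A := (proj A).comp (constSeq A)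

/-- The ⋆-endomorphism of `ℓ^∞(ℕ, A)` obtained by applying a ⋆-endomorphism of `A` termwise. -/
def ellMap {A : Type u} [CStarAlgebra A] (σ : A →⋆ₐ[ℂ] A) : EllInfty A →⋆ₐ[ℂ] EllInfty A where
  toFun x := BoundedContinuousFunction.ofNormedAddCommGroup (fun n => σ (x n))
    continuous_of_discreteTopology ‖x‖
    (fun n => (NonUnitalStarAlgHom.norm_apply_le σ (x n)).trans (x.norm_coe_le_norm n))
  map_one' := by ext n; exact map_one σ
  map_mul' x y := by ext n; exact map_mul σ (x n) (y n)
  map_zero' := by ext n; exact map_zero σ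
  map_add' x y := by ext n; exact map_add σ (x n) (y n)
  commutes' c := by ext n; exact AlgHomClass.commutes σ c
  map_star' x := by ext n; exact map_star σ (x n)

theorem ellMap_apply {A : Type u} [CStarAlgebra A] (σ : A →⋆ₐ[ℂ] A) (x : EllInfty A) (n : ℕ) :
    ellMap σ x n = σ (x n) := rfl

theorem ellMap_mem_cZero {A : Type u} [CStarAlgebra A] (σ : A →⋆ₐ[ℂ] A) {x : EllInfty A}
    (hx : x ∈ cZero A) : ellMap σ x ∈ cZero A :=
  squeeze_zero (fun _ => norm_nonneg _)
    (fun n => NonUnitalStarAlgHom.norm_apply_le σ (x n)) (mem_cZero.1 hx)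

/-- The ring endomorphism of `A_∞` induced by a ⋆-endomorphism of `A`. -/
def inftyRingHom {A : Type u} [CStarAlgebra A] (σ : A →⋆ₐ[ℂ] A) : AInfty A →+* AInfty A :=
  Ideal.Quotient.lift (cZero A) ((mkRingHom A).comp (ellMap σ).toAlgHom.toRingHom)
    (fun _ hx => Ideal.Quotient.eq_zero_iff_mem.2 (ellMap_mem_cZero σ hx))

theorem inftyRingHom_mk {A : Type u} [CStarAlgebra A] (σ : A →⋆ₐ[ℂ] A) (x : EllInfty A) :
    inftyRingHom σ (mkRingHom A x) = mkRingHom A (ellMap σ x) := rfl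

/-- The ⋆-endomorphism of `A_∞` induced by a ⋆-endomorphism of `A`. -/
def inftyMap {A : Type u} [CStarAlgebra A] (σ : A →⋆ₐ[ℂ] A) : AInfty A →⋆ₐ[ℂ] AInfty A where
  toRingHom := inftyRingHom σ
  commutes' c := by
    have h : inftyRingHom σ (mkRingHom A (algebraMap ℂ (EllInfty A) c)) =
        mkRingHom A (algebraMap ℂ (EllInfty A) c) := by
      rw [inftyRingHom_mk, AlgHomClass.commutes]
    exact h
  map_star' x := by
    obtain ⟨x, rfl⟩ := Ideal.Quotient.mk_surjective x
    have h : inftyRingHom σ (star (mkRingHom A x)) = star (inftyRingHom σ (mkRingHom A x)) := by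
      rw [star_mk, inftyRingHom_mk, inftyRingHom_mk, star_mk, map_star]
    exact h

theorem inftyMap_proj {A : Type u} [CStarAlgebra A] (σ : A →⋆ₐ[ℂ] A) (x : EllInfty A) :
    inftyMap σ (proj A x) = proj A (ellMap σ x) := rfl

/-- The central sequence algebra `A_∞ ∩ A'`: the relative commutant in `A_∞` of (the image
under `ι_A` of) `A`. -/
def centralSeqAlgebra (A : Type u) [CStarAlgebra A] : StarSubalgebra ℂ (AInfty A) :=
  StarSubalgebra.centralizer ℂ (Set.range (iota A))

section Action

variable {G : Type v} [Group G] {A : Type u} [CStarAlgebra A]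

/-- The automorphism `\bar α_g` of `ℓ^∞(ℕ, A)` induced by an action `α` of `G` on `A`. -/
def ellAction (α : G →* (A ≃⋆ₐ[ℂ] A)) (g : G) : EllInfty A →⋆ₐ[ℂ] EllInfty A :=
  ellMap (α g : A →⋆ₐ[ℂ] A)

/-- The automorphism `\bar α_g` of `A_∞` induced by an action `α` of `G` on `A`. -/
def inftyAction (α : G →* (A ≃⋆ₐ[ℂ] A)) (g : G) : AInfty A →⋆ₐ[ℂ] AInfty A :=
  inftyMap (α g : A →⋆ₐ[ℂ] A)

/-- Strong continuity: `g ↦ α_g(a)` is norm continuous for every `a ∈ A`. -/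
def StronglyContinuous [TopologicalSpace G] (α : G →* (A ≃⋆ₐ[ℂ] A)) : Prop :=
  ∀ a : A, Continuous fun g => α g a

/-- `ℓ^{∞,(α)}(ℕ, A)`: the elements `x` of `ℓ^∞(ℕ, A)` on which the induced action is continuous,
i.e. for which `g ↦ \bar α_g(x)` is continuous for the sup norm. -/
def ellContinuous [TopologicalSpace G] (α : G →* (A ≃⋆ₐ[ℂ] A)) :
    StarSubalgebra ℂ (EllInfty A) where
  carrier := {x | Continuous fun g => ellAction α g x}
  mul_mem' := by
    intro x y hx hy
    have h : Continuous fun g => ellAction α g x * ellAction α g y := Continuous.mul hx hy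
    change Continuous fun g => ellAction α g (x * y)
    simpa only [map_mul] using h
  add_mem' := by
    intro x y hx hy
    have h : Continuous fun g => ellAction α g x + ellAction α g y := Continuous.add hx hy
    change Continuous fun g => ellAction α g (x + y)
    simpa only [map_add] using h
  algebraMap_mem' := by
    intro c
    have h : Continuous fun _ : G => algebraMap ℂ (EllInfty A) c := continuous_const
    have e : (fun g => ellAction α g (algebraMap ℂ (EllInfty A) c)) =
        fun _ : G => algebraMap ℂ (EllInfty A) c :=
      funext fun g => AlgHomClass.commutes (ellAction α g) c
    change Continuous fun g => ellAction α g (algebraMap ℂ (EllInfty A) c)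
    rw [e]
    exact h
  star_mem' := by
    intro x hx
    have h : Continuous fun g => star (ellAction α g x) := Continuous.star hx
    change Continuous fun g => ellAction α g (star x)
    simpa only [map_star] using h

/-- `A_∞^{(α)} = ℓ^{∞,(α)}(ℕ, A) / C₀(ℕ, A)`, realised inside `A_∞` as the image of
`ℓ^{∞,(α)}(ℕ, A)` under the quotient map. -/
def inftyContinuous [TopologicalSpace G] (α : G →* (A ≃⋆ₐ[ℂ] A)) :
    StarSubalgebra ℂ (AInfty A) :=
  (ellContinuous α).map (proj A)

/-- The Rokhlin property for a strongly continuous action `α` of a compact group `G` on `A`: there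
is a unital embedding `θ` of `C(G)` into `A_∞^{(α)} ∩ A'` which intertwines left translation
`f ↦ (h ↦ f(g⁻¹h))` with the induced action `\bar α`. -/
def HasRokhlinProperty [TopologicalSpace G] [IsTopologicalGroup G] (α : G →* (A ≃⋆ₐ[ℂ] A)) :
    Prop :=
  ∃ θ : C(G, ℂ) →⋆ₐ[ℂ] (inftyContinuous α ⊓ centralSeqAlgebra A : StarSubalgebra ℂ (AInfty A)),
    Function.Injective θ ∧
      ∀ (g : G) (f : C(G, ℂ)),
        inftyAction α g (θ f : AInfty A) = (θ (f.comp (ContinuousMap.mulLeft g⁻¹)) : AInfty A)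

/-- The fixed point subalgebra of `A_∞ ∩ A'` under the action of `G` induced by `α`. -/
def fixedCentralSeqAlgebra (α : G →* (A ≃⋆ₐ[ℂ] A)) : StarSubalgebra ℂ (AInfty A) where
  carrier := {x | x ∈ centralSeqAlgebra A ∧ ∀ g : G, inftyAction α g x = x}
  mul_mem' := by
    rintro x y ⟨hx, hx'⟩ ⟨hy, hy'⟩
    exact ⟨mul_mem hx hy, fun g => by rw [map_mul, hx', hy']⟩
  add_mem' := by
    rintro x y ⟨hx, hx'⟩ ⟨hy, hy'⟩
    exact ⟨add_mem hx hy, fun g => by rw [map_add, hx', hy']⟩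
  algebraMap_mem' := by
    intro c
    exact ⟨algebraMap_mem _ c, fun g => AlgHomClass.commutes _ c⟩
  star_mem' := by
    rintro x ⟨hx, hx'⟩
    exact ⟨star_mem hx, fun g => by rw [map_star, hx']⟩

end Action

/-- `B` admits a central sequence of unital embeddings into `A`: there are injective unital
⋆-homomorphisms `ψ_n : B → A` with `‖[ψ_n(b), a]‖ → 0` for all `b ∈ B`, `a ∈ A`. -/
def AdmitsCentralSequence (B : Type v) (A : Type u) [CStarAlgebra B] [CStarAlgebra A] : Prop :=
  ∃ ψ : ℕ → (B →⋆ₐ[ℂ] A), (∀ n, Function.Injective (ψ n)) ∧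
    ∀ (b : B) (a : A), Tendsto (fun n => ‖ψ n b * a - a * ψ n b‖) atTop (𝓝 0)

end CentralSeq

end

/-!
Since `C(G, A)` is `C(G) ⊗ A`, a Rokhlin map `θ` and `ι_A` combine to an equivariant ⋆-homomorphism
`Θ : C(G, A) → A_∞`. Orbit functions `h ↦ α_h(a)` are invariant under the diagonal action of `G` on
`C(G, A)`, so `a ↦ Θ(h ↦ α_h(a))` is a ⋆-homomorphism from `A` to the fixed points of `A_∞`. Compose
it with `ψ_n : B → A` for large `n`: as `G` is compact, all `α_h(ψ_n(b))` nearly commute with a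
given finite set simultaneously, and hence so does the image of `b`. Riemann sums
`∑ x, T x⋆ * α_x(c) * T x` lift these homomorphisms approximately to `ℓ^{∞,(α)}(ℕ, A)`, and a
diagonal sequence of coordinates of the lifts defines the embedding. The norm of a prescribed
element is nearly preserved after first applying a suitable `α_g` to `ψ_n`.
-/

noncomputable section

namespace CentralSeq

section SequenceAlgebra

variable {A : Type*} [CStarAlgebra A]

theorem proj_eq_zero_iff {x : EllInfty A} : proj A x = 0 ↔ x ∈ cZero A :=
  Ideal.Quotient.eq_zero_iff_mem

theorem proj_surjective : Function.Surjective (proj A) :=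
  Ideal.Quotient.mk_surjective

instance isClosed_cZero : IsClosed (cZero A : Set (EllInfty A)) := by
  refine isClosed_of_closure_subset fun x hx => Metric.tendsto_atTop.2 fun ε hε => ?_
  obtain ⟨y, hy, hxy⟩ := Metric.mem_closure_iff.1 hx (ε / 2) (half_pos hε)
  obtain ⟨N, hN⟩ := Metric.tendsto_atTop.1 (mem_cZero.1 hy) (ε / 2) (half_pos hε)
  refine ⟨N, fun n hn => ?_⟩
  have hyn : ‖y n‖ < ε / 2 := by simpa using hN n hn
  have hxyn : ‖x n - y n‖ < ε / 2 :=
    ((x - y).norm_coe_le_norm n).trans_lt (by rwa [← dist_eq_norm])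
  rw [dist_zero_right, norm_norm]
  calc ‖x n‖ ≤ ‖x n - y n‖ + ‖y n‖ := norm_le_norm_sub_add _ _
    _ < ε := by linarith

theorem norm_proj_le (x : EllInfty A) : ‖proj A x‖ ≤ ‖x‖ :=
  Submodule.Quotient.norm_mk_le (cZero A) x

theorem eventually_norm_lt_of_norm_proj_lt {x : EllInfty A} {r : ℝ} (h : ‖proj A x‖ < r) :
    ∀ᶠ n in atTop, ‖x n‖ < r := by
  obtain ⟨y, hyx, hy⟩ := Submodule.Quotient.norm_mk_lt (proj A x) (sub_pos.2 h)
  have hxy : x - y ∈ cZero A := proj_eq_zero_iff.1 (by rw [map_sub, sub_eq_zero]; exact hyx.symm)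
  rw [add_sub_cancel] at hy
  filter_upwards [hxy.eventually_lt_const (sub_pos.2 hy)] with n hn
  calc ‖x n‖ ≤ ‖x n - y n‖ + ‖y n‖ := norm_le_norm_sub_add _ _
    _ < r - ‖y‖ + ‖y‖ := add_lt_add_of_lt_of_le hn (y.norm_coe_le_norm n)
    _ = r := sub_add_cancel _ _

theorem norm_proj_le_of_eventually {x : EllInfty A} {r : ℝ} (h : ∀ᶠ n in atTop, ‖x n‖ ≤ r) :
    ‖proj A x‖ ≤ r := by
  obtain ⟨N, hN⟩ := eventually_atTop.1 h
  have hr : 0 ≤ r := (norm_nonneg _).trans (hN N le_rfl)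
  let y : EllInfty A := .ofNormedAddCommGroup (fun n => if N ≤ n then x n else 0)
    continuous_of_discreteTopology r (fun n => by
      split_ifs with hn
      exacts [hN n hn, by simpa using hr])
  have hxy : proj A x = proj A y := by
    rw [← sub_eq_zero, ← map_sub, proj_eq_zero_iff, mem_cZero]
    refine tendsto_const_nhds.congr' ?_
    filter_upwards [eventually_ge_atTop N] with n hn
    simp [y, hn]
  rw [hxy]
  exact (norm_proj_le y).trans (norm_ofNormedAddCommGroup_le _ hr _)

theorem frequently_lt_norm_of_lt_norm_proj {x : EllInfty A} {r : ℝ} (h : r < ‖proj A x‖) :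
    ∃ᶠ n in atTop, r < ‖x n‖ := by
  contrapose! h
  exact norm_proj_le_of_eventually (by simpa using h)

theorem AInfty.norm_mul_le (x y : AInfty A) : ‖x * y‖ ≤ ‖x‖ * ‖y‖ := by
  obtain ⟨x, rfl⟩ := proj_surjective x
  obtain ⟨y, rfl⟩ := proj_surjective y
  refine le_mul_of_forall_lt₀ fun a ha b hb => ?_
  rw [← map_mul]
  apply norm_proj_le_of_eventually
  filter_upwards [eventually_norm_lt_of_norm_proj_lt ha, eventually_norm_lt_of_norm_proj_lt hb]
    with n hxn hyn
  exact norm_mul_le_of_le hxn.le hyn.le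

theorem AInfty.norm_mul_self_le (x : AInfty A) : ‖x‖ * ‖x‖ ≤ ‖star x * x‖ := by
  obtain ⟨x, rfl⟩ := proj_surjective x
  refine le_of_forall_gt_imp_ge_of_dense fun r hr => ?_
  have hr₀ : 0 ≤ r := (norm_nonneg _).trans hr.le
  rw [← map_star, ← map_mul] at hr
  have hx : ‖proj A x‖ ≤ √r := by
    apply norm_proj_le_of_eventually
    filter_upwards [eventually_norm_lt_of_norm_proj_lt hr] with n hn
    refine Real.le_sqrt_of_sq_le ?_
    rw [sq, ← CStarRing.norm_star_mul_self]
    exact hn.le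
  exact (mul_self_le_mul_self (norm_nonneg _) hx).trans_eq (Real.mul_self_sqrt hr₀)

instance : CStarAlgebra (AInfty A) where
  __ := (inferInstance : Algebra ℂ (AInfty A))
  dist_eq := dist_eq_norm_neg_add
  norm_mul_le := AInfty.norm_mul_le
  norm_mul_self_le := AInfty.norm_mul_self_le
  norm_smul_le := norm_smul_le
  star_smul := star_smul

theorem norm_iota (a : A) : ‖iota A a‖ = ‖a‖ := by
  refine le_antisymm (NonUnitalStarAlgHom.norm_apply_le (iota A) a) (le_of_forall_gt fun r hr => ?_)
  exact (eventually_norm_lt_of_norm_proj_lt hr).exists.choose_spec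

end SequenceAlgebra

section ConjSum

variable {ι A : Type*} [Fintype ι]

/-- The conjugate sum `c ↦ ∑ i, s i⋆ * c i * s i`: a noncommutative weighted average, where the
weights are the positive elements `s i⋆ * s i`. -/
def conjSum [Ring A] [StarRing A] [Algebra ℂ A] (s : ι → A) : (ι → A) →ₗ[ℂ] A :=
  ∑ i, LinearMap.mulLeftRight ℂ (star (s i), s i) ∘ₗ LinearMap.proj i

section Algebraic

variable [Ring A] [StarRing A] [Algebra ℂ A]

theorem conjSum_apply (s c : ι → A) : conjSum s c = ∑ i, star (s i) * c i * s i := by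
  simp [conjSum]

theorem conjSum_mul_right (s c : ι → A) {a : A} (h : ∀ i, Commute (s i) a) :
    conjSum s (fun i => c i * a) = conjSum s c * a := by
  simp only [conjSum_apply, Finset.sum_mul, mul_assoc, (h _).eq]

theorem conjSum_const {s : ι → A} (hs : ∑ i, star (s i) * s i = 1) {a : A}
    (h : ∀ i, Commute (s i) a) : conjSum s (fun _ => a) = a := by
  simpa [conjSum_apply, hs] using conjSum_mul_right s 1 h

theorem star_conjSum (s c : ι → A) : star (conjSum s c) = conjSum s (star c) := by
  simp [conjSum_apply, star_sum, mul_assoc]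

theorem map_conjSum {D F : Type*} [Ring D] [StarRing D] [Algebra ℂ D] [FunLike F A D]
    [AlgHomClass F ℂ A D] [StarHomClass F A D] (φ : F) (s c : ι → A) :
    φ (conjSum s c) = conjSum (fun i => φ (s i)) (fun i => φ (c i)) := by
  simp only [conjSum_apply, map_sum, map_mul, map_star]

end Algebraic

variable [CStarAlgebra A]

open scoped WithCStarModule in
/-- The Cauchy–Schwarz inequality in the Hilbert module `A^ι`, for the vectors `(s i⋆)` and
`(s i⋆ * c i)`. -/
theorem norm_conjSum_le (s c : ι → A) {M : ℝ} (hM : 0 ≤ M) (hc : ∀ i, s i ≠ 0 → ‖c i‖ ≤ M) :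
    ‖conjSum s c‖ ≤ M * ‖∑ i, star (s i) * s i‖ := by
  let _ := CStarAlgebra.spectralOrder A
  have := CStarAlgebra.spectralOrderedRing A
  set S := ∑ i, star (s i) * s i with hS
  let x : C⋆ᵐᵒᵈ(A, ι → A) := (WithCStarModule.equiv A _).symm fun i => star (s i)
  let y : C⋆ᵐᵒᵈ(A, ι → A) := (WithCStarModule.equiv A _).symm fun i => star (s i) * c i
  have hxy : conjSum s c = inner A x y := by
    simp [x, y, conjSum_apply, WithCStarModule.pi_inner, WithCStarModule.inner_def]
  have hx : ‖x‖ ^ 2 = ‖S‖ := by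
    simp [x, hS, WithCStarModule.pi_norm_sq, WithCStarModule.inner_def]
  have hterm (i : ι) : star (s i) * (c i * star (c i)) * s i ≤ M ^ 2 • (star (s i) * s i) := by
    by_cases hi : s i = 0
    · simp [hi]
    · have hnorm : ‖c i * star (c i)‖ ≤ M ^ 2 := by
        rw [CStarRing.norm_self_mul_star, ← sq]
        exact pow_le_pow_left₀ (norm_nonneg _) (hc i hi) 2
      exact (CStarAlgebra.star_left_conjugate_le_norm_smul (.mul_star_self _)).trans
        (smul_le_smul_of_nonneg_right hnorm (star_mul_self_nonneg _))
  have hy : ‖y‖ ^ 2 ≤ M ^ 2 * ‖S‖ := by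
    calc ‖y‖ ^ 2 = ‖∑ i, star (s i) * (c i * star (c i)) * s i‖ := by
          simp [y, WithCStarModule.pi_norm_sq, WithCStarModule.inner_def, mul_assoc]
      _ ≤ ‖M ^ 2 • S‖ := by
          refine CStarAlgebra.norm_le_norm_of_nonneg_of_le (Finset.sum_nonneg fun i _ =>
            star_left_conjugate_nonneg (mul_star_self_nonneg _) _) ?_
          rw [hS, Finset.smul_sum]
          exact Finset.sum_le_sum fun i _ => hterm i
      _ = M ^ 2 * ‖S‖ := by rw [norm_smul, norm_pow, Real.norm_of_nonneg hM]
  calc ‖conjSum s c‖ ≤ ‖x‖ * ‖y‖ := hxy ▸ CStarModule.norm_inner_le _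
    _ ≤ M * ‖S‖ := abs_le_of_sq_le_sq' ?_ (by positivity) |>.2
  calc (‖x‖ * ‖y‖) ^ 2 = ‖S‖ * ‖y‖ ^ 2 := by rw [mul_pow, hx]
    _ ≤ ‖S‖ * (M ^ 2 * ‖S‖) := by gcongr
    _ = (M * ‖S‖) ^ 2 := by ring

theorem norm_conjSum_le_of_sum_eq_one {s : ι → A} (hs : ∑ i, star (s i) * s i = 1) {c : ι → A}
    {M : ℝ} (hM : 0 ≤ M) (hc : ∀ i, s i ≠ 0 → ‖c i‖ ≤ M) : ‖conjSum s c‖ ≤ M := by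
  obtain _ | _ := subsingleton_or_nontrivial A
  · simpa [Subsingleton.elim (conjSum s c) 0] using hM
  · simpa [hs] using norm_conjSum_le s c hM hc

theorem exists_norm_conjSum_le [Nonempty ι] {s : ι → A} (hs : ∑ i, star (s i) * s i = 1)
    (c : ι → A) : ∃ i, ‖conjSum s c‖ ≤ ‖c i‖ := by
  obtain ⟨i, hi⟩ := Finite.exists_max fun i => ‖c i‖
  exact ⟨i, norm_conjSum_le_of_sum_eq_one hs (norm_nonneg _) fun j _ => hi j⟩

end ConjSum

section ContinuousFunctions

variable {X : Type*} [TopologicalSpace X]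

theorem exists_sqPartition_subordinate [CompactSpace X] [NormalSpace X] {V : X → Set X}
    (hV : ∀ x, V x ∈ 𝓝 x) :
    ∃ (t : Finset X) (f : t → C(X, ℂ)), ∑ i, star (f i) * f i = 1 ∧
      ∀ i y, f i y ≠ 0 → y ∈ V i := by
  obtain ⟨t, -, ht⟩ := isCompact_univ.elim_nhds_subcover (fun x => interior (V x)) fun x _ =>
    interior_mem_nhds.2 (hV x)
  obtain ⟨p, hp⟩ := PartitionOfUnity.exists_isSubordinate isClosed_univ
    (fun x : t => interior (V x)) (fun _ => isOpen_interior) <|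
      by simpa [Set.iUnion_subtype] using ht
  refine ⟨t, fun i => ⟨fun y => (√(p i y) : ℝ), by fun_prop⟩, ?_, fun i y hy => ?_⟩
  · ext y
    have hsum : ∑ i ∈ t.attach, p i y = 1 := by
      rw [← p.sum_eq_one (Set.mem_univ y), finsum_eq_sum_of_fintype, Finset.univ_eq_attach]
    simp [← Complex.ofReal_mul, Real.mul_self_sqrt (p.nonneg _ y), ← Complex.ofReal_sum, hsum]
  · refine interior_subset (hp i (subset_tsupport _ fun h => hy ?_))
    simp [h]

variable (X) (A : Type*) [CStarAlgebra A]

/-- The embedding `f ↦ f ⊗ 1` of `C(X)` into `C(X, A) = C(X) ⊗ A`. -/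
def scalarHom : C(X, ℂ) →⋆ₐ[ℂ] C(X, A) :=
  ContinuousMap.compStarAlgHom X (StarAlgHom.ofId ℂ A) (continuous_algebraMap ℂ A)

/-- The embedding `a ↦ 1 ⊗ a` of `A` into `C(X, A) = C(X) ⊗ A` as constant functions. -/
def constHom : A →⋆ₐ[ℂ] C(X, A) where
  toFun := ContinuousMap.const X
  map_one' := rfl
  map_mul' _ _ := rfl
  map_zero' := rfl
  map_add' _ _ := rfl
  commutes' _ := rfl
  map_star' _ := rfl

variable {X A}

@[simp]
theorem scalarHom_apply (f : C(X, ℂ)) (x : X) : scalarHom X A f x = algebraMap ℂ A (f x) := rfl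

@[simp]
theorem constHom_apply (a : A) (x : X) : constHom X A a x = a := rfl

theorem commute_scalarHom (f : C(X, ℂ)) (F : C(X, A)) : Commute (scalarHom X A f) F :=
  ContinuousMap.ext fun x => Algebra.commutes (f x) (F x)

theorem conjSum_continuousMap_apply {ι : Type*} [Fintype ι] (s c : ι → C(X, A)) (x : X) :
    conjSum s c x = conjSum (fun i => s i x) (fun i => c i x) := by
  simp [conjSum_apply]

theorem sum_star_mul_self_map {ι : Type*} [Fintype ι] {D E : Type*} [Ring D] [StarRing D]
    [Algebra ℂ D] [Ring E] [StarRing E] [Algebra ℂ E] (θ : D →⋆ₐ[ℂ] E)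
    {f : ι → D} (hf : ∑ i, star (f i) * f i = 1) :
    ∑ i, star (θ (f i)) * θ (f i) = 1 := by
  simp only [← map_star, ← map_mul, ← map_sum, hf, map_one]

theorem norm_conjSum_scalarHom_sub_le [CompactSpace X] {ι : Type*} [Fintype ι] {f : ι → C(X, ℂ)}
    (hf : ∑ i, star (f i) * f i = 1) {c : ι → C(X, A)} {F : C(X, A)} {δ : ℝ} (hδ : 0 ≤ δ)
    (hc : ∀ i x, f i x ≠ 0 → ‖c i x - F x‖ ≤ δ) :
    ‖conjSum (fun i => scalarHom X A (f i)) c - F‖ ≤ δ := by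
  have hF : conjSum (fun i => scalarHom X A (f i)) (fun _ => F) = F :=
    conjSum_const (sum_star_mul_self_map _ hf) fun i => commute_scalarHom (f i) F
  rw [← hF, ← map_sub, ContinuousMap.norm_le _ hδ]
  intro x
  have hfx : ∑ i, star (scalarHom X A (f i) x) * scalarHom X A (f i) x = 1 := by
    simpa using congr($(sum_star_mul_self_map (scalarHom X A) hf) x)
  rw [conjSum_continuousMap_apply]
  refine norm_conjSum_le_of_sum_eq_one hfx hδ fun i hi => hc i x fun h0 => hi ?_
  rw [scalarHom_apply, h0, map_zero]

end ContinuousFunctions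

section Extension

variable {D E : Type*} [CStarAlgebra D] [CStarAlgebra E]

theorem exists_starAlgHom_of_denseRange {ι : Type*} {e : ι → D} (he : DenseRange e)
    (φ : D →L[ℂ] E) (one : φ 1 = 1) (mul : ∀ i j, φ (e i * e j) = φ (e i) * φ (e j))
    (star : ∀ i, φ (star (e i)) = star (φ (e i))) : ∃ ψ : D →⋆ₐ[ℂ] E, ⇑ψ = φ := by
  have map_mul (x y : D) : φ (x * y) = φ x * φ y :=
    he.induction_on₂ (isClosed_eq (by fun_prop) (by fun_prop)) mul x y
  have map_star (x : D) : φ (Star.star x) = Star.star (φ x) :=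
    he.induction_on x (isClosed_eq (by fun_prop) (by fun_prop)) star
  exact ⟨{ AlgHom.ofLinearMap (φ : D →ₗ[ℂ] E) one map_mul with map_star' := map_star }, rfl⟩

theorem exists_starAlgHom_comp_eq {R : Type*} [Ring R] [StarRing R] [Algebra ℂ R]
    {S : R →⋆ₐ[ℂ] D} (hS : DenseRange S) (T : R →⋆ₐ[ℂ] E) (hTS : ∀ z, ‖T z‖ ≤ ‖S z‖) :
    ∃ Θ : D →⋆ₐ[ℂ] E, ∀ z, Θ (S z) = T z := by
  let φ : D →L[ℂ] E := T.toLinearMap.extendOfNorm S.toLinearMap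
  have hφ (z : R) : φ (S z) = T z :=
    LinearMap.extendOfNorm_eq (f := T.toLinearMap) (e := S.toLinearMap) hS ⟨1, by simpa using hTS⟩ z
  obtain ⟨Θ, hΘ⟩ := exists_starAlgHom_of_denseRange hS φ
    (by rw [← map_one S, hφ, map_one])
    (fun x y => by rw [← map_mul, hφ, hφ, hφ, map_mul])
    (fun x => by rw [← map_star, hφ, hφ, map_star])
  exact ⟨Θ, fun z => by rw [hΘ, hφ]⟩

end Extension

section TensorProduct

open scoped TensorProduct

section Lift

variable {C D E : Type*} [Ring C] [StarRing C] [Algebra ℂ C] [StarModule ℂ C]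
  [Ring D] [StarRing D] [Algebra ℂ D] [StarModule ℂ D] [Ring E] [StarRing E] [Algebra ℂ E]

/-- The ⋆-homomorphism `C ⊗ D → E` on the algebraic tensor product induced by ⋆-homomorphisms of
`C` and of `D` into `E` with commuting ranges. -/
def tensorLift (θ : C →⋆ₐ[ℂ] E) (j : D →⋆ₐ[ℂ] E) (h : ∀ c d, Commute (θ c) (j d)) :
    C ⊗[ℂ] D →⋆ₐ[ℂ] E where
  __ := Algebra.TensorProduct.lift θ.toAlgHom j.toAlgHom h
  map_star' z := by
    change Algebra.TensorProduct.lift θ.toAlgHom j.toAlgHom h (star z) =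
      star (Algebra.TensorProduct.lift θ.toAlgHom j.toAlgHom h z)
    induction z with
    | zero => simp
    | add z w hz hw => rw [star_add, map_add, hz, hw, map_add, star_add]
    | tmul c d => simpa [map_star] using (h (star c) (star d)).eq

@[simp]
theorem tensorLift_tmul (θ : C →⋆ₐ[ℂ] E) (j : D →⋆ₐ[ℂ] E) (h : ∀ c d, Commute (θ c) (j d))
    (c : C) (d : D) : tensorLift θ j h (c ⊗ₜ d) = θ c * j d := rfl

end Lift

variable {X : Type*} [TopologicalSpace X] {A E : Type*} [CStarAlgebra A] [CStarAlgebra E]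

variable (X A) in
/-- The inclusion of the algebraic tensor product `C(X) ⊗ A` into `C(X, A)`. -/
def tensorInclusion : C(X, ℂ) ⊗[ℂ] A →⋆ₐ[ℂ] C(X, A) :=
  tensorLift (scalarHom X A) (constHom X A) fun f _ => commute_scalarHom f _

theorem tensorInclusion_tmul_apply (f : C(X, ℂ)) (a : A) (x : X) :
    tensorInclusion X A (f ⊗ₜ a) x = f x • a := (Algebra.smul_def (f x) a).symm

variable [CompactSpace X]

theorem denseRange_tensorInclusion [NormalSpace X] : DenseRange (tensorInclusion X A) := by
  refine Metric.denseRange_iff.2 fun F r hr => ?_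
  obtain ⟨t, f, hf, hfV⟩ := exists_sqPartition_subordinate
    fun x => F.continuous.continuousAt.preimage_mem_nhds (Metric.ball_mem_nhds (F x) (half_pos hr))
  refine ⟨∑ i, (star (f i) * f i) ⊗ₜ F i, ?_⟩
  have hsum : tensorInclusion X A (∑ i, (star (f i) * f i) ⊗ₜ F i) =
      conjSum (fun i => scalarHom X A (f i)) (fun i => constHom X A (F i)) := by
    simp only [conjSum_apply, map_sum, tensorInclusion, tensorLift_tmul, map_mul, map_star,
      mul_assoc, (commute_scalarHom _ _).eq]
  rw [dist_comm, dist_eq_norm, hsum]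
  refine (norm_conjSum_scalarHom_sub_le hf (half_pos hr).le fun i x hx => ?_).trans_lt
    (half_lt_self hr)
  rw [← dist_eq_norm, dist_comm]
  exact (hfV i x hx).le

theorem exists_forall_norm_mul_sub_conjSum_le {θ : C(X, ℂ) →⋆ₐ[ℂ] E} {j : A →⋆ₐ[ℂ] E}
    (h : ∀ f a, Commute (θ f) (j a)) (g : C(X, ℂ)) (a : A) {ε : ℝ} (hε : 0 < ε) :
    ∃ V : X → Set X, (∀ x, V x ∈ 𝓝 x) ∧ ∀ (t : Finset X) (f : t → C(X, ℂ)),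
      ∑ i, star (f i) * f i = 1 → (∀ i y, f i y ≠ 0 → y ∈ V i) →
        ‖θ g * j a - conjSum (fun i => θ (f i)) (fun i => j (g i • a))‖ ≤ ε := by
  set δ := ε / (‖a‖ + 1)
  have hδ₀ : 0 < δ := by positivity
  refine ⟨fun x => g ⁻¹' Metric.ball (g x) δ,
    fun x => g.continuous.continuousAt.preimage_mem_nhds (Metric.ball_mem_nhds _ hδ₀),
    fun t f hf hfV => ?_⟩
  let s : C(X, ℂ) := conjSum f fun i => algebraMap ℂ C(X, ℂ) (g i)
  have hg : ‖g - s‖ ≤ δ := by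
    rw [norm_sub_rev]
    refine norm_conjSum_scalarHom_sub_le hf hδ₀.le fun i x hx => ?_
    rw [← dist_eq_norm, dist_comm]
    exact (hfV i x hx).le
  have hs : conjSum (fun i => θ (f i)) (fun i => j (g i • a)) = θ s * j a := by
    rw [map_conjSum, ← conjSum_mul_right _ _ fun i => h _ a]
    simp [AlgHomClass.commutes, Algebra.smul_def]
  rw [hs, ← sub_mul, ← map_sub]
  calc _ ≤ ‖g - s‖ * ‖a‖ := norm_mul_le_of_le (NonUnitalStarAlgHom.norm_apply_le θ _)
        (NonUnitalStarAlgHom.norm_apply_le j a)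
    _ ≤ δ * (‖a‖ + 1) := by gcongr; simp
    _ = ε := div_mul_cancel₀ ε (by positivity)

theorem exists_forall_norm_tensorLift_sub_le {θ : C(X, ℂ) →⋆ₐ[ℂ] E} {j : A →⋆ₐ[ℂ] E}
    (h : ∀ f a, Commute (θ f) (j a)) (z : C(X, ℂ) ⊗[ℂ] A) {ε : ℝ} (hε : 0 < ε) :
    ∃ V : X → Set X, (∀ x, V x ∈ 𝓝 x) ∧ ∀ (t : Finset X) (f : t → C(X, ℂ)),
      ∑ i, star (f i) * f i = 1 → (∀ i y, f i y ≠ 0 → y ∈ V i) →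
        ‖tensorLift θ j h z - conjSum (fun i => θ (f i))
          (fun i => j (tensorInclusion X A z i))‖ ≤ ε := by
  induction z generalizing ε with
  | zero => exact ⟨fun _ => Set.univ, fun _ => univ_mem, fun t f _ _ => by
      simpa [conjSum_apply] using hε.le⟩
  | add z w hz hw =>
    obtain ⟨V, hV, hzV⟩ := hz (half_pos hε)
    obtain ⟨W, hW, hwW⟩ := hw (half_pos hε)
    refine ⟨fun x => V x ∩ W x, fun x => inter_mem (hV x) (hW x), fun t f hf hfVW => ?_⟩
    have hadd := norm_add_le_of_le (hzV t f hf fun i y hy => (hfVW i y hy).1)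
      (hwW t f hf fun i y hy => (hfVW i y hy).2)
    rw [add_halves, ← add_sub_add_comm, ← map_add, ← map_add] at hadd
    simpa [Pi.add_def] using hadd
  | tmul g a =>
    simpa only [tensorLift_tmul, tensorInclusion_tmul_apply] using
      exists_forall_norm_mul_sub_conjSum_le h g a hε

theorem norm_tensorLift_le [NormalSpace X] {θ : C(X, ℂ) →⋆ₐ[ℂ] E} {j : A →⋆ₐ[ℂ] E}
    (h : ∀ f a, Commute (θ f) (j a)) (z : C(X, ℂ) ⊗[ℂ] A) :
    ‖tensorLift θ j h z‖ ≤ ‖tensorInclusion X A z‖ := by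
  refine le_of_forall_pos_le_add fun ε hε => ?_
  obtain ⟨V, hV, hzV⟩ := exists_forall_norm_tensorLift_sub_le h z hε
  obtain ⟨t, f, hf, hfV⟩ := exists_sqPartition_subordinate hV
  have hsum : ‖conjSum (fun i => θ (f i)) (fun i => j (tensorInclusion X A z i))‖ ≤
      ‖tensorInclusion X A z‖ :=
    norm_conjSum_le_of_sum_eq_one (sum_star_mul_self_map θ hf) (norm_nonneg _) fun i _ =>
      (NonUnitalStarAlgHom.norm_apply_le j _).trans (ContinuousMap.norm_coe_le_norm _ _)
  calc _ ≤ _ := norm_le_norm_add_norm_sub' _ _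
    _ ≤ _ := add_le_add hsum (hzV t f hf hfV)

theorem exists_starAlgHom_scalarHom_constHom [NormalSpace X] {θ : C(X, ℂ) →⋆ₐ[ℂ] E}
    {j : A →⋆ₐ[ℂ] E} (h : ∀ f a, Commute (θ f) (j a)) :
    ∃ Θ : C(X, A) →⋆ₐ[ℂ] E, (∀ f, Θ (scalarHom X A f) = θ f) ∧ ∀ a, Θ (constHom X A a) = j a := by
  obtain ⟨Θ, hΘ⟩ := exists_starAlgHom_comp_eq (R := C(X, ℂ) ⊗[ℂ] A)
    denseRange_tensorInclusion (tensorLift θ j h) (norm_tensorLift_le h)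
  refine ⟨Θ, fun f => ?_, fun a => ?_⟩
  · simpa [tensorInclusion] using hΘ (f ⊗ₜ 1)
  · simpa [tensorInclusion] using hΘ (1 ⊗ₜ a)

open scoped CStarAlgebra in
theorem starAlgHom_ext_scalarHom_constHom [NormalSpace X] {Θ Ξ : C(X, A) →⋆ₐ[ℂ] E}
    (hscalar : ∀ f, Θ (scalarHom X A f) = Ξ (scalarHom X A f))
    (hconst : ∀ a, Θ (constHom X A a) = Ξ (constHom X A a)) : Θ = Ξ := by
  refine DFunLike.coe_injective ((denseRange_tensorInclusion (X := X) (A := A)).equalizer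
    (map_continuous Θ) (map_continuous Ξ) (funext fun z => ?_))
  induction z with
  | zero => simp
  | add z w hz hw => simp_all
  | tmul f a => simp [tensorInclusion, hscalar, hconst]

theorem norm_conjSum_map_scalarHom_sub_le (Θ : C(X, A) →⋆ₐ[ℂ] E) {ι : Type*} [Fintype ι]
    {f : ι → C(X, ℂ)} (hf : ∑ i, star (f i) * f i = 1) {c : ι → C(X, A)} {F : C(X, A)} {δ : ℝ}
    (hδ : 0 ≤ δ) (hc : ∀ i x, f i x ≠ 0 → ‖c i x - F x‖ ≤ δ) :
    ‖conjSum (fun i => Θ (scalarHom X A (f i))) (fun i => Θ (c i)) - Θ F‖ ≤ δ := by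
  rw [← map_conjSum, ← map_sub]
  exact (NonUnitalStarAlgHom.norm_apply_le Θ _).trans (norm_conjSum_scalarHom_sub_le hf hδ hc)

end TensorProduct

section Dynamics

variable {G A : Type*} [Group G] [CStarAlgebra A] {α : G →* (A ≃⋆ₐ[ℂ] A)}

theorem action_mul_apply (g h : G) (a : A) : α (g * h) a = α g (α h a) := by
  rw [map_mul]; rfl

theorem norm_inftyAction_sub_le {g : G} {x : AInfty A} (hx : inftyAction α g x = x)
    (y : AInfty A) : ‖inftyAction α g y - y‖ ≤ 2 * ‖y - x‖ := by
  calc ‖inftyAction α g y - y‖ = ‖inftyAction α g (y - x) - (y - x)‖ := by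
        rw [map_sub, hx, sub_sub_sub_cancel_right]
    _ ≤ ‖y - x‖ + ‖y - x‖ := norm_sub_le_of_le (NonUnitalStarAlgHom.norm_apply_le _ _) le_rfl
    _ = 2 * ‖y - x‖ := (two_mul _).symm

variable [TopologicalSpace G]

/-- The embedding of `A` into `C(G, A)` sending `a` to its orbit function `h ↦ α_h(a)`. -/
def orbitHom (hα : StronglyContinuous α) : A →⋆ₐ[ℂ] C(G, A) where
  toFun a := ⟨fun h => α h a, hα a⟩
  map_one' := by ext h; exact map_one (α h)
  map_mul' a b := by ext h; exact map_mul (α h) a b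
  map_zero' := by ext h; exact map_zero (α h)
  map_add' a b := by ext h; exact map_add (α h) a b
  commutes' c := by ext h; exact AlgHomClass.commutes (α h) c
  map_star' a := by ext h; exact map_star (α h) a

@[simp]
theorem orbitHom_apply (hα : StronglyContinuous α) (a : A) (h : G) :
    orbitHom hα a h = α h a := rfl

variable [IsTopologicalGroup G]

open scoped CStarAlgebra in
variable (α) in
/-- The diagonal action of `G` on `C(G, A) = C(G) ⊗ A`, by left translation on `C(G)` and by `α`
on `A`. -/
def diagAction (g : G) : C(G, A) →⋆ₐ[ℂ] C(G, A) :=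
  (ContinuousMap.compStarAlgHom G (α g : A →⋆ₐ[ℂ] A) (map_continuous (α g))).comp
    (ContinuousMap.compStarAlgHom' ℂ A (ContinuousMap.mulLeft g⁻¹))

theorem diagAction_apply (g : G) (F : C(G, A)) (h : G) :
    diagAction α g F h = α g (F (g⁻¹ * h)) := rfl

theorem diagAction_scalarHom (g : G) (f : C(G, ℂ)) :
    diagAction α g (scalarHom G A f) = scalarHom G A (f.comp (ContinuousMap.mulLeft g⁻¹)) := by
  ext h
  exact AlgHomClass.commutes (α g) _

theorem diagAction_constHom (g : G) (a : A) :
    diagAction α g (constHom G A a) = constHom G A (α g a) := rfl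

theorem diagAction_orbitHom (hα : StronglyContinuous α) (g : G) (a : A) :
    diagAction α g (orbitHom hα a) = orbitHom hα a := by
  ext h
  rw [diagAction_apply, orbitHom_apply, ← action_mul_apply, mul_inv_cancel_left, orbitHom_apply]

variable (α) in
/-- `Θ : C(G, A) → A_∞` is an equivariant extension of `ι_A` which maps `C(G)` into `A_∞^{(α)}`.
Rokhlin maps `θ : C(G) → A_∞^{(α)} ∩ A'` correspond to such `Θ` by `Θ (f ⊗ a) = θ(f) ι_A(a)`. -/
structure IsRokhlinHom (Θ : C(G, A) →⋆ₐ[ℂ] AInfty A) : Prop where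
  map_constHom : ∀ a, Θ (constHom G A a) = iota A a
  map_diagAction : ∀ g F, Θ (diagAction α g F) = inftyAction α g (Θ F)
  map_scalarHom_mem : ∀ f, Θ (scalarHom G A f) ∈ inftyContinuous α

theorem HasRokhlinProperty.exists_isRokhlinHom [CompactSpace G] (h : HasRokhlinProperty α) :
    ∃ Θ, IsRokhlinHom α Θ := by
  obtain ⟨θ, -, hθ⟩ := h
  let θ' : C(G, ℂ) →⋆ₐ[ℂ] AInfty A := (StarSubalgebra.subtype _).comp θ
  have hcomm (f : C(G, ℂ)) (a : A) : Commute (θ' f) (iota A a) :=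
    ((StarSubalgebra.mem_centralizer_iff ℂ).1 (θ f).2.2 _ (Set.mem_range_self a)).1.symm
  obtain ⟨Θ, hΘθ, hΘι⟩ := exists_starAlgHom_scalarHom_constHom hcomm
  refine ⟨Θ, hΘι, fun g => ?_, fun f => hΘθ f ▸ (θ f).2.1⟩
  suffices Θ.comp (diagAction α g) = (inftyAction α g).comp Θ from DFunLike.congr_fun this
  apply starAlgHom_ext_scalarHom_constHom
  · intro f
    simp only [StarAlgHom.comp_apply, diagAction_scalarHom, hΘθ]
    exact (hθ g f).symm
  · intro a
    simp only [StarAlgHom.comp_apply, diagAction_constHom, hΘι]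
    rfl

namespace IsRokhlinHom

variable {Θ : C(G, A) →⋆ₐ[ℂ] AInfty A} (hα : StronglyContinuous α)

theorem inftyAction_orbitHom (hΘ : IsRokhlinHom α Θ) (g : G) (a : A) :
    inftyAction α g (Θ (orbitHom hα a)) = Θ (orbitHom hα a) := by
  rw [← hΘ.map_diagAction, diagAction_orbitHom]

variable [CompactSpace G]

theorem norm_orbitHom_mul_sub_le (hΘ : IsRokhlinHom α Θ) {a c : A} {M : ℝ}
    (h : ∀ g, ‖α g c * a - a * α g c‖ ≤ M) :
    ‖Θ (orbitHom hα c) * iota A a - iota A a * Θ (orbitHom hα c)‖ ≤ M := by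
  rw [← hΘ.map_constHom, ← map_mul, ← map_mul, ← map_sub]
  exact (NonUnitalStarAlgHom.norm_apply_le Θ _).trans
    ((ContinuousMap.norm_le _ ((norm_nonneg _).trans (h 1))).2 h)

/-- The translate by `g` cannot be dropped: for the translation action on `C(G)`, `Θ ∘ orbitHom` may
be the evaluation at a point. -/
theorem exists_norm_le_norm_orbitHom_add (hΘ : IsRokhlinHom α Θ) (a : A) {ε : ℝ} (hε : 0 < ε) :
    ∃ g, ‖a‖ ≤ ‖Θ (orbitHom hα (α g a))‖ + ε := by
  have hV (x : G) : {h | ‖α (h * x⁻¹) a - a‖ ≤ ε} ∈ 𝓝 x := by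
    have hx : Tendsto (fun h => ‖α (h * x⁻¹) a - a‖) (𝓝 x) (𝓝 0) := by
      have hcont : Continuous fun h => ‖α (h * x⁻¹) a - a‖ :=
        (((hα a).comp (continuous_mul_const x⁻¹)).sub continuous_const).norm
      simpa using hcont.tendsto x
    exact hx.eventually_le_const hε
  obtain ⟨t, f, hf, hfV⟩ := exists_sqPartition_subordinate hV
  have hΘf : ∑ i, star (Θ (scalarHom G A (f i))) * Θ (scalarHom G A (f i)) = 1 :=
    sum_star_mul_self_map (Θ.comp (scalarHom G A)) hf
  have hconst := norm_conjSum_map_scalarHom_sub_le Θ hf hε.le (F := constHom G A a)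
    (c := fun i => orbitHom hα (α (i : G)⁻¹ a)) fun i h hh => by
      simpa [← action_mul_apply] using hfV i h hh
  have : Nonempty t := by
    by_contra! ht
    simpa using congr($hf 1)
  obtain ⟨x, hx⟩ := exists_norm_conjSum_le hΘf fun i => Θ (orbitHom hα (α (i : G)⁻¹ a))
  refine ⟨(x : G)⁻¹, ?_⟩
  calc ‖a‖ = ‖Θ (constHom G A a)‖ := by rw [hΘ.map_constHom, norm_iota]
    _ ≤ _ := norm_le_norm_add_norm_sub _ _
    _ ≤ _ := add_le_add hx hconst

end IsRokhlinHom

end Dynamics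

section OrbitSum

variable {G A : Type*} [Group G] [CStarAlgebra A] {α : G →* (A ≃⋆ₐ[ℂ] A)}

theorem constSeq_apply (a : A) (k : ℕ) : constSeq A a k = a := rfl

variable (α) in
/-- The linear map `c ↦ ∑ x, T x⋆ * α_x(c) * T x` into sequences: a Riemann sum for the orbit map,
where `T` lifts the square roots of a partition of unity. -/
def orbitSum {t : Finset G} (T : t → EllInfty A) : A →ₗ[ℂ] EllInfty A :=
  conjSum T ∘ₗ LinearMap.pi fun x => ((constSeq A).comp (α x : A →⋆ₐ[ℂ] A) : A →ₗ[ℂ] EllInfty A)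

theorem orbitSum_apply {t : Finset G} (T : t → EllInfty A) (c : A) :
    orbitSum α T c = conjSum T fun x => constSeq A (α x c) := rfl

theorem orbitSum_apply_apply {t : Finset G} (T : t → EllInfty A) (c : A) (k : ℕ) :
    orbitSum α T c k = conjSum (fun x => T x k) fun x => α x c := by
  simp [orbitSum_apply, conjSum_apply, constSeq_apply]

variable [TopologicalSpace G]

theorem constSeq_mem_ellContinuous (hα : StronglyContinuous α) (a : A) :
    constSeq A a ∈ ellContinuous α := by
  have : Continuous (constSeq A) := AddMonoidHomClass.continuous_of_bound _ 1 fun a => by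
    simpa using NonUnitalStarAlgHom.norm_apply_le (constSeq A) a
  exact this.comp (hα a)

variable (α) in
/-- `Y` is a ⋆-preserving linear map into `ℓ^{∞,(α)}(ℕ, A)` whose late coordinates all have norm at
most `2`. Such maps are used as approximate lifts of ⋆-homomorphisms into `A_∞`. -/
structure IsEquicontinuousLift {B : Type*} [CStarAlgebra B] (Y : B →ₗ[ℂ] EllInfty A) : Prop where
  map_star : ∀ c, Y (star c) = star (Y c)
  mem_ellContinuous : ∀ c, Y c ∈ ellContinuous α
  eventually_norm_le : ∀ᶠ k in atTop, ∀ c, ‖Y c k‖ ≤ 2 * ‖c‖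

theorem IsEquicontinuousLift.comp {B D : Type*} [CStarAlgebra B] [CStarAlgebra D]
    {Y : D →ₗ[ℂ] EllInfty A} (hY : IsEquicontinuousLift α Y) (ρ : B →⋆ₐ[ℂ] D) :
    IsEquicontinuousLift α (Y ∘ₗ (ρ : B →ₗ[ℂ] D)) where
  map_star b := by
    rw [LinearMap.comp_apply, LinearMap.comp_apply, ← hY.map_star]
    exact congrArg Y (StarHomClass.map_star ρ b)
  mem_ellContinuous b := hY.mem_ellContinuous (ρ b)
  eventually_norm_le := by
    filter_upwards [hY.eventually_norm_le] with k hk b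
    exact (hk (ρ b)).trans (by gcongr; exact NonUnitalStarAlgHom.norm_apply_le ρ b)

theorem isEquicontinuousLift_orbitSum (hα : StronglyContinuous α) {t : Finset G}
    {T : t → EllInfty A} (hT : ∀ x, T x ∈ ellContinuous α)
    (hsum : ∑ x, star (proj A (T x)) * proj A (T x) = 1) :
    IsEquicontinuousLift α (orbitSum α T) where
  map_star c := by
    simp only [orbitSum_apply, star_conjSum, map_star]
    rfl
  mem_ellContinuous c := by
    rw [orbitSum_apply, conjSum_apply]
    exact sum_mem fun x _ => mul_mem
      (mul_mem (star_mem (hT x)) (constSeq_mem_ellContinuous hα _)) (hT x)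
  eventually_norm_le := by
    have hone : ‖proj A (∑ x, star (T x) * T x)‖ < 2 := by
      simp only [map_sum, map_mul, map_star, hsum]
      have := NonUnitalStarAlgHom.norm_apply_le (StarAlgHom.ofId ℂ (AInfty A)) 1
      simp only [map_one, norm_one] at this
      exact this.trans_lt one_lt_two
    filter_upwards [eventually_norm_lt_of_norm_proj_lt hone] with k hk c
    rw [orbitSum_apply_apply, mul_comm 2]
    refine (norm_conjSum_le (ι := t) _ _ (norm_nonneg c) fun x _ =>
      NonUnitalStarAlgHom.norm_apply_le (α (x : G) : A →⋆ₐ[ℂ] A) c).trans ?_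
    gcongr
    simpa using hk.le

variable [IsTopologicalGroup G] [CompactSpace G]

theorem IsRokhlinHom.exists_isEquicontinuousLift {Θ : C(G, A) →⋆ₐ[ℂ] AInfty A}
    (hΘ : IsRokhlinHom α Θ) (hα : StronglyContinuous α) (F : Finset A) {δ : ℝ} (hδ : 0 < δ) :
    ∃ Y : A →ₗ[ℂ] EllInfty A, IsEquicontinuousLift α Y ∧
      ∀ c ∈ F, ‖proj A (Y c) - Θ (orbitHom hα c)‖ ≤ δ := by
  have hV (x : G) : {h | ∀ c ∈ F, ‖α x c - α h c‖ ≤ δ} ∈ 𝓝 x := by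
    refine F.eventually_all.2 fun c _ => ?_
    simpa only [dist_eq_norm'] using
      (hα c).continuousAt.eventually (Metric.closedBall_mem_nhds _ hδ)
  obtain ⟨t, f, hf, hfV⟩ := exists_sqPartition_subordinate hV
  choose T hT hTf using fun x => StarSubalgebra.mem_map.1 (hΘ.map_scalarHom_mem (f x))
  refine ⟨orbitSum α T, isEquicontinuousLift_orbitSum hα hT ?_, fun c hc => ?_⟩
  · simp only [hTf]
    exact sum_star_mul_self_map (Θ.comp (scalarHom G A)) hf
  · have hY : proj A (orbitSum α T c) = conjSum (fun x => Θ (scalarHom G A (f x)))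
        fun x => Θ (constHom G A (α x c)) := by
      simp only [orbitSum_apply, map_conjSum, hTf, hΘ.map_constHom]
      rfl
    rw [hY]
    exact norm_conjSum_map_scalarHom_sub_le Θ hf hδ.le fun x h hh => hfV x h hh c hc

theorem IsRokhlinHom.exists_tendsto_isEquicontinuousLift {Θ : C(G, A) →⋆ₐ[ℂ] AInfty A}
    (hΘ : IsRokhlinHom α Θ) (hα : StronglyContinuous α) :
    ∃ Y : Finset A × ℕ → A →ₗ[ℂ] EllInfty A, (∀ p, IsEquicontinuousLift α (Y p)) ∧
      ∀ c, Tendsto (fun p => proj A (Y p c)) atTop (𝓝 (Θ (orbitHom hα c))) := by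
  choose Y hY hYF using fun p : Finset A × ℕ =>
    hΘ.exists_isEquicontinuousLift hα p.1 (Nat.one_div_pos_of_nat (α := ℝ) (n := p.2))
  refine ⟨Y, hY, fun c => tendsto_iff_norm_sub_tendsto_zero.2 ?_⟩
  have hlim : Tendsto (fun p : Finset A × ℕ => 1 / ((p.2 : ℝ) + 1)) atTop (𝓝 0) := by
    rw [← prod_atTop_atTop_eq]
    exact tendsto_one_div_add_atTop_nhds_zero_nat.comp tendsto_snd
  refine squeeze_zero' (.of_forall fun _ => norm_nonneg _) ?_ hlim
  filter_upwards [eventually_ge_atTop ({c}, 0)] with p hp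
  exact hYF p c (Finset.singleton_subset_iff.1 hp.1)

end OrbitSum

section UniformConvergence

variable {A : Type*} [CStarAlgebra A]

theorem eventually_forall_norm_lt {X : Type*} [TopologicalSpace X] [CompactSpace X]
    {F : X → EllInfty A} (hF : Continuous F) {ε : ℝ} (hε : ∀ x, ‖proj A (F x)‖ < ε) :
    ∀ᶠ n in atTop, ∀ x, ‖F x n‖ < ε := by
  suffices ∀ᶠ n in atTop, ∀ x ∈ Set.univ, ‖F x n‖ < ε by simpa using this
  refine isCompact_univ.induction_on (by simp) (fun s t hst => ?_) (fun s t hs ht => ?_)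
    fun x _ => ?_
  · exact fun ht => ht.mono fun n h x hx => h x (hst hx)
  · filter_upwards [hs, ht] with n hsn htn x hx
    exact hx.elim (hsn x) (htn x)
  · obtain ⟨r, hxr, hrε⟩ := exists_between (hε x)
    refine ⟨F ⁻¹' Metric.ball (F x) (ε - r), mem_nhdsWithin_of_mem_nhds <|
      hF.continuousAt.preimage_mem_nhds (Metric.ball_mem_nhds _ (sub_pos.2 hrε)), ?_⟩
    filter_upwards [eventually_norm_lt_of_norm_proj_lt hxr] with n hn y hy
    calc ‖F y n‖ ≤ ‖F x n‖ + ‖F y n - F x n‖ := norm_le_norm_add_norm_sub' _ _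
      _ ≤ ‖F x n‖ + ‖F y - F x‖ := by gcongr; exact (F y - F x).norm_coe_le_norm n
      _ < r + (ε - r) := add_lt_add hn (mem_ball_iff_norm.1 hy)
      _ = ε := add_sub_cancel _ _

theorem eventually_eventually_norm_lt {P : Type*} {l : Filter P} {x : P → EllInfty A}
    {X : AInfty A} (hx : Tendsto (fun p => proj A (x p)) l (𝓝 X)) {ε : ℝ} (hX : ‖X‖ < ε) :
    ∀ᶠ p in l, ∀ᶠ k in atTop, ‖x p k‖ < ε :=
  (hx.norm.eventually_lt_const hX).mono fun _ => eventually_norm_lt_of_norm_proj_lt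

end UniformConvergence

section Approximation

variable {G A : Type*} [Group G] [TopologicalSpace G] [CompactSpace G] [CStarAlgebra A]
  {α : G →* (A ≃⋆ₐ[ℂ] A)}

theorem eventually_forall_norm_action_sub_lt {y : EllInfty A} (hy : y ∈ ellContinuous α) {ε : ℝ}
    (h : ∀ g, ‖inftyAction α g (proj A y) - proj A y‖ < ε) :
    ∀ᶠ n in atTop, ∀ g, ‖α g (y n) - y n‖ < ε :=
  eventually_forall_norm_lt (F := fun g => ellAction α g y - y) (hy.sub continuous_const)
    fun g => by rw [map_sub]; exact h g

variable {B : Type*} [CStarAlgebra B]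

variable (α) in
/-- `φ` is a ⋆-preserving linear map with `‖φ‖ ≤ 2` which, up to `ε`, is unital and, on `F`, is
multiplicative, commutes with `H` and takes values fixed by `α`. The homomorphism into the fixed
points of `A_∞ ∩ A'` is the limit of a sequence of such maps. -/
structure IsApproxCentralHom (F : Finset B) (H : Finset A) (ε : ℝ) (φ : B →ₗ[ℂ] A) : Prop where
  map_star : ∀ b, φ (star b) = star (φ b)
  norm_le : ∀ b, ‖φ b‖ ≤ 2 * ‖b‖
  norm_one_sub_le : ‖φ 1 - 1‖ ≤ ε
  norm_mul_sub_le : ∀ b ∈ F, ∀ c ∈ F, ‖φ (b * c) - φ b * φ c‖ ≤ ε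
  norm_comm_le : ∀ b ∈ F, ∀ a ∈ H, ‖φ b * a - a * φ b‖ ≤ ε
  norm_action_sub_le : ∀ b ∈ F, ∀ g, ‖α g (φ b) - φ b‖ ≤ ε

theorem eventually_isApproxCentralHom {P : Type*} {l : Filter P} {Y : P → B →ₗ[ℂ] EllInfty A}
    (hY : ∀ p, IsEquicontinuousLift α (Y p)) {Φ : B →⋆ₐ[ℂ] AInfty A}
    (hΦ : ∀ b, Tendsto (fun p => proj A (Y p b)) l (𝓝 (Φ b)))
    (hinv : ∀ g b, inftyAction α g (Φ b) = Φ b) {F : Finset B} {H : Finset A} {ε : ℝ}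
    (hcomm : ∀ b ∈ F, ∀ a ∈ H, ‖Φ b * iota A a - iota A a * Φ b‖ < ε) (hε : 0 < ε) :
    ∀ᶠ p in l, ∀ᶠ k in atTop,
      IsApproxCentralHom α F H ε ((evalCLM ℂ k : EllInfty A →L[ℂ] A) ∘ₗ Y p) := by
  have hone : ∀ᶠ p in l, ∀ᶠ k in atTop, ‖(Y p 1 - 1) k‖ < ε :=
    eventually_eventually_norm_lt (by simpa using (hΦ 1).sub_const 1) (by simpa using hε)
  have hmul : ∀ᶠ p in l, ∀ᶠ k in atTop, ∀ b ∈ F, ∀ c ∈ F,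
      ‖(Y p (b * c) - Y p b * Y p c) k‖ < ε := by
    simp only [F.eventually_all]
    exact fun b _ c _ => eventually_eventually_norm_lt
      (by simpa using (hΦ (b * c)).sub ((hΦ b).mul (hΦ c))) (by simpa using hε)
  have hcomm : ∀ᶠ p in l, ∀ᶠ k in atTop, ∀ b ∈ F, ∀ a ∈ H,
      ‖(Y p b * constSeq A a - constSeq A a * Y p b) k‖ < ε := by
    simp only [F.eventually_all, H.eventually_all]
    refine fun b hb a ha => eventually_eventually_norm_lt ?_ (hcomm b hb a ha)
    simp only [map_sub, map_mul]
    exact ((hΦ b).mul_const (iota A a)).sub ((hΦ b).const_mul (iota A a))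
  have hinv : ∀ᶠ p in l, ∀ᶠ k in atTop, ∀ b ∈ F, ∀ g, ‖α g (Y p b k) - Y p b k‖ < ε := by
    simp only [F.eventually_all]
    intro b _
    filter_upwards [(tendsto_iff_norm_sub_tendsto_zero.1 (hΦ b)).eventually_lt_const
      (half_pos hε)] with p hp
    refine eventually_forall_norm_action_sub_lt ((hY p).mem_ellContinuous b) fun g => ?_
    linarith [norm_inftyAction_sub_le (hinv g b) (proj A (Y p b))]
  filter_upwards [hone, hmul, hcomm, hinv] with p h₁ h₂ h₃ h₄
  filter_upwards [h₁, h₂, h₃, h₄, (hY p).eventually_norm_le] with k k₁ k₂ k₃ k₄ hk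
  exact ⟨fun b => congr($((hY p).map_star b) k), hk, k₁.le, fun b hb c hc => (k₂ b hb c hc).le,
    fun b hb a ha => (k₃ b hb a ha).le, fun b hb g => (k₄ b hb g).le⟩

variable [IsTopologicalGroup G]

theorem eventually_forall_norm_action_mul_sub_lt (hα : StronglyContinuous α) (x : EllInfty A)
    (a : A) (h : ∀ a, Tendsto (fun n => ‖x n * a - a * x n‖) atTop (𝓝 0)) {ε : ℝ} (hε : 0 < ε) :
    ∀ᶠ n in atTop, ∀ g, ‖α g (x n) * a - a * α g (x n)‖ < ε := by
  let F (g : G) : EllInfty A := x * constSeq A (α g⁻¹ a) - constSeq A (α g⁻¹ a) * x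
  have hconst : Continuous fun g => constSeq A (α g⁻¹ a) :=
    (constSeq_mem_ellContinuous hα a).comp continuous_inv
  have hF : Continuous F := (continuous_const.mul hconst).sub (hconst.mul continuous_const)
  have hproj (g : G) : proj A (F g) = 0 := proj_eq_zero_iff.2 (h (α g⁻¹ a))
  filter_upwards [eventually_forall_norm_lt hF fun g => by simpa [hproj] using hε] with n hn g
  have hg : α g (α g⁻¹ a) = a := by rw [← action_mul_apply, mul_inv_cancel, map_one]; rfl
  calc ‖α g (x n) * a - a * α g (x n)‖ = ‖α g (F g n)‖ := by
          simp [F, constSeq_apply, -map_inv, hg]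
    _ = ‖F g n‖ := StarAlgEquiv.norm_map (α g) _
    _ < ε := hn g

theorem AdmitsCentralSequence.exists_norm_action_mul_sub_le (hB : AdmitsCentralSequence B A)
    (hα : StronglyContinuous α) (F : Finset B) (H : Finset A) {ε : ℝ} (hε : 0 < ε) :
    ∃ ψ : B →⋆ₐ[ℂ] A, Function.Injective ψ ∧
      ∀ b ∈ F, ∀ a ∈ H, ∀ g, ‖α g (ψ b) * a - a * α g (ψ b)‖ ≤ ε := by
  obtain ⟨ψ, hψ, hcomm⟩ := hB
  let Ψ (b : B) : EllInfty A := .ofNormedAddCommGroup (fun n => ψ n b)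
    continuous_of_discreteTopology ‖b‖ fun n => NonUnitalStarAlgHom.norm_apply_le (ψ n) b
  have hFH : ∀ᶠ n in atTop, ∀ b ∈ F, ∀ a ∈ H, ∀ g,
      ‖α g (ψ n b) * a - a * α g (ψ n b)‖ < ε :=
    F.eventually_all.2 fun b _ => H.eventually_all.2 fun a _ =>
      eventually_forall_norm_action_mul_sub_lt hα (Ψ b) a (hcomm b) hε
  obtain ⟨n, hn⟩ := hFH.exists
  exact ⟨ψ n, hψ n, fun b hb a ha g => (hn b hb a ha g).le⟩

theorem AdmitsCentralSequence.exists_starAlgHom_norm_le (hB : AdmitsCentralSequence B A)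
    {Θ : C(G, A) →⋆ₐ[ℂ] AInfty A} (hΘ : IsRokhlinHom α Θ) (hα : StronglyContinuous α)
    (F : Finset B) (H : Finset A) (b₀ : B) {ε : ℝ} (hε : 0 < ε) :
    ∃ ρ : B →⋆ₐ[ℂ] A, ‖b₀‖ ≤ ‖Θ (orbitHom hα (ρ b₀))‖ + ε ∧ ∀ b ∈ F, ∀ a ∈ H,
      ‖Θ (orbitHom hα (ρ b)) * iota A a - iota A a * Θ (orbitHom hα (ρ b))‖ ≤ ε := by
  obtain ⟨ψ, hψ, hcomm⟩ := hB.exists_norm_action_mul_sub_le hα F H hε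
  obtain ⟨l, hl⟩ := hΘ.exists_norm_le_norm_orbitHom_add hα (ψ b₀) hε
  rw [NonUnitalStarAlgHom.norm_map ψ hψ] at hl
  refine ⟨(α l : A →⋆ₐ[ℂ] A).comp ψ, hl, fun b hb a ha =>
    hΘ.norm_orbitHom_mul_sub_le hα fun g => ?_⟩
  simpa [action_mul_apply] using hcomm b hb a ha (g * l)

theorem exists_isApproxCentralHom {Θ : C(G, A) →⋆ₐ[ℂ] AInfty A} (hΘ : IsRokhlinHom α Θ)
    (hα : StronglyContinuous α) (hB : AdmitsCentralSequence B A) (F : Finset B) (H : Finset A)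
    (b₀ : B) {ε : ℝ} (hε : 0 < ε) :
    ∃ φ : B →ₗ[ℂ] A, IsApproxCentralHom α F H ε φ ∧ ‖b₀‖ ≤ ‖φ b₀‖ + ε := by
  classical
  obtain ⟨ρ, hρ, hcomm⟩ := hB.exists_starAlgHom_norm_le hΘ hα F H b₀ (half_pos hε)
  obtain ⟨Y, hY, hYlim⟩ := hΘ.exists_tendsto_isEquicontinuousLift hα
  let Φ : B →⋆ₐ[ℂ] AInfty A := (Θ.comp (orbitHom hα)).comp ρ
  have hΦ (b : B) : Tendsto (fun p => proj A (Y p (ρ b))) atTop (𝓝 (Φ b)) := hYlim (ρ b)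
  have happrox := eventually_isApproxCentralHom (Y := fun p => Y p ∘ₗ (ρ : B →ₗ[ℂ] A))
    (fun p => (hY p).comp ρ) hΦ (fun g b => hΘ.inftyAction_orbitHom hα g (ρ b))
    (fun b hb a ha => (hcomm b hb a ha).trans_lt (half_lt_self hε)) hε
  have hlower : ∀ᶠ p in atTop, ‖b₀‖ - ε < ‖proj A (Y p (ρ b₀))‖ :=
    (hΦ b₀).norm.eventually_const_lt (lt_of_lt_of_le (by linarith) (sub_le_iff_le_add.2 hρ))
  obtain ⟨p, hp, hpb₀⟩ := (happrox.and hlower).exists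
  obtain ⟨k, hk, hkb₀⟩ := ((frequently_lt_norm_of_lt_norm_proj hpb₀).and_eventually hp).exists
  exact ⟨_, hkb₀, by simpa using (sub_lt_iff_lt_add.1 hk).le⟩

end Approximation

section LimitMap

open scoped CStarAlgebra

variable {A B : Type*} [CStarAlgebra A] [CStarAlgebra B]

/-- The linear map `b ↦ (φ_k(b))_k` into `ℓ^∞(ℕ, A)` of a uniformly bounded sequence of linear
maps. -/
def seqMap (φ : ℕ → B →ₗ[ℂ] A) {M : ℝ} (hφ : ∀ k b, ‖φ k b‖ ≤ M * ‖b‖) : B →ₗ[ℂ] EllInfty A where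
  toFun b := .ofNormedAddCommGroup (fun k => φ k b) continuous_of_discreteTopology (M * ‖b‖)
    fun k => hφ k b
  map_add' b c := by ext k; exact map_add (φ k) b c
  map_smul' z b := by ext k; exact map_smul (φ k) z b

/-- The bounded linear map into `A_∞` sending `b` to the class of the sequence `(φ_k(b))_k`. -/
def limitMap (φ : ℕ → B →ₗ[ℂ] A) {M : ℝ} (hφ : ∀ k b, ‖φ k b‖ ≤ M * ‖b‖) : B →L[ℂ] AInfty A :=
  ((proj A : EllInfty A →ₗ[ℂ] AInfty A) ∘ₗ seqMap φ hφ).mkContinuous M fun b =>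
    (norm_proj_le _).trans <|
      (norm_ofNormedAddCommGroup_le _ ((norm_nonneg _).trans (hφ 0 b)) fun k => hφ k b)

theorem limitMap_apply {φ : ℕ → B →ₗ[ℂ] A} {M : ℝ} (hφ : ∀ k b, ‖φ k b‖ ≤ M * ‖b‖) (b : B) :
    limitMap φ hφ b = proj A (seqMap φ hφ b) := rfl

theorem proj_eq_proj_of_eventually {x y : EllInfty A}
    (h : ∀ᶠ k : ℕ in atTop, ‖x k - y k‖ ≤ 1 / ((k : ℝ) + 1)) : proj A x = proj A y := by
  rw [← sub_eq_zero, ← map_sub, proj_eq_zero_iff]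
  exact squeeze_zero' (.of_forall fun _ => norm_nonneg _) h tendsto_one_div_add_atTop_nhds_zero_nat

theorem le_norm_proj_of_frequently {x : EllInfty A} {r : ℝ}
    (h : ∃ᶠ k : ℕ in atTop, r ≤ ‖x k‖ + 1 / ((k : ℝ) + 1)) : r ≤ ‖proj A x‖ := by
  by_contra! hr
  obtain ⟨s, hxs, hsr⟩ := exists_between hr
  have hsmall : ∀ᶠ k : ℕ in atTop, 1 / ((k : ℝ) + 1) < r - s :=
    tendsto_one_div_add_atTop_nhds_zero_nat.eventually_lt_const (sub_pos.2 hsr)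
  obtain ⟨k, hk, hks, hk'⟩ :=
    (h.and_eventually ((eventually_norm_lt_of_norm_proj_lt hxs).and hsmall)).exists
  linarith

theorem norm_le_norm_limitMap {φ : ℕ → B →ₗ[ℂ] A} {M : ℝ}
    (hM : ∀ k b, ‖φ k b‖ ≤ M * ‖b‖) {u : ℕ → B} (hu : DenseRange u)
    (hlower : ∀ i, ∃ᶠ k : ℕ in atTop, ‖u i‖ ≤ ‖φ k (u i)‖ + 1 / ((k : ℝ) + 1)) (b : B) :
    ‖b‖ ≤ ‖limitMap φ hM b‖ :=
  hu.induction_on b (isClosed_le (by fun_prop) (by fun_prop)) fun i =>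
    le_norm_proj_of_frequently (hlower i)

variable {G : Type*} [Group G] {α : G →* (A ≃⋆ₐ[ℂ] A)}

theorem mem_fixedCentralSeqAlgebra_iff {x : AInfty A} :
    x ∈ fixedCentralSeqAlgebra α ↔
      (∀ a, x * iota A a = iota A a * x) ∧ ∀ g, inftyAction α g x = x := by
  refine and_congr_left fun _ => ⟨fun h a => ?_, fun h => ?_⟩
  · exact ((StarSubalgebra.mem_centralizer_iff ℂ).1 h _ (Set.mem_range_self a)).1.symm
  · rw [centralSeqAlgebra, StarSubalgebra.mem_centralizer_iff, Set.forall_mem_range]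
    exact fun a => ⟨(h a).symm, by rw [← map_star, h]⟩

theorem isClosed_fixedCentralSeqAlgebra :
    IsClosed (fixedCentralSeqAlgebra α : Set (AInfty A)) := by
  have heq : (fixedCentralSeqAlgebra α : Set (AInfty A)) =
      (⋂ a, {x | x * iota A a = iota A a * x}) ∩ ⋂ g, {x | inftyAction α g x = x} := by
    ext x
    simp [mem_fixedCentralSeqAlgebra_iff]
  rw [heq]
  exact (isClosed_iInter fun a => isClosed_eq (by fun_prop) (by fun_prop)).inter
    (isClosed_iInter fun g => isClosed_eq (map_continuous _) continuous_id)

section ApproximateHomomorphisms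

theorem eventually_mem_image_range {X : Type*} [DecidableEq X] (u : ℕ → X) (i : ℕ) :
    ∀ᶠ k in atTop, u i ∈ (Finset.range k).image u := by
  filter_upwards [eventually_gt_atTop i] with k hk
  exact Finset.mem_image_of_mem u (Finset.mem_range.2 hk)

variable [DecidableEq A] [DecidableEq B] {u : ℕ → B} {v : ℕ → A} {φ : ℕ → B →ₗ[ℂ] A}
  (hφ : ∀ k : ℕ, IsApproxCentralHom α ((Finset.range k).image u) ((Finset.range k).image v)
    (1 / ((k : ℝ) + 1)) (φ k))

include hφ

theorem exists_starAlgHom_eq_limitMap (hu : DenseRange u) :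
    ∃ ψ : B →⋆ₐ[ℂ] AInfty A, ⇑ψ = limitMap φ fun k => (hφ k).norm_le := by
  refine exists_starAlgHom_of_denseRange hu _ ?_ (fun i j => ?_) fun i => ?_
  · exact proj_eq_proj_of_eventually (x := seqMap φ _ 1) (y := 1)
      (.of_forall fun k => (hφ k).norm_one_sub_le)
  · simp only [limitMap_apply, ← map_mul]
    refine proj_eq_proj_of_eventually ?_
    filter_upwards [eventually_mem_image_range u i, eventually_mem_image_range u j] with k hi hj
    exact (hφ k).norm_mul_sub_le _ hi _ hj
  · simp only [limitMap_apply, ← map_star]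
    congr 1
    ext k
    exact (hφ k).map_star (u i)

theorem limitMap_mem_fixedCentralSeqAlgebra (hu : DenseRange u) (hv : DenseRange v) (b : B) :
    limitMap φ (fun k => (hφ k).norm_le) b ∈ fixedCentralSeqAlgebra α := by
  have hι : Continuous (iota A) := map_continuous _
  refine hu.induction_on b (isClosed_fixedCentralSeqAlgebra.preimage (map_continuous _)) fun i =>
    mem_fixedCentralSeqAlgebra_iff.2 ⟨fun a => ?_, fun g => ?_⟩
  · refine hv.induction_on a (isClosed_eq (by fun_prop) (by fun_prop)) fun j => ?_
    refine proj_eq_proj_of_eventually (x := seqMap φ _ (u i) * constSeq A (v j)) ?_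
    filter_upwards [eventually_mem_image_range u i, eventually_mem_image_range v j] with k hi hj
    exact (hφ k).norm_comm_le _ hi _ hj
  · refine proj_eq_proj_of_eventually (x := ellAction α g (seqMap φ _ (u i))) ?_
    filter_upwards [eventually_mem_image_range u i] with k hi
    exact (hφ k).norm_action_sub_le _ hi g

theorem exists_injective_starAlgHom_fixedCentralSeqAlgebra (hu : DenseRange u) (hv : DenseRange v)
    (hlower : ∀ i, ∃ᶠ k : ℕ in atTop, ‖u i‖ ≤ ‖φ k (u i)‖ + 1 / ((k : ℝ) + 1)) :
    ∃ Φ : B →⋆ₐ[ℂ] fixedCentralSeqAlgebra α, Function.Injective Φ := by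
  obtain ⟨ψ, hψ⟩ := exists_starAlgHom_eq_limitMap hφ hu
  have hmem (b : B) : ψ b ∈ fixedCentralSeqAlgebra α :=
    hψ ▸ limitMap_mem_fixedCentralSeqAlgebra hφ hu hv b
  have hinj : Function.Injective ψ := (injective_iff_map_eq_zero ψ).2 fun b hb => by
    have hle := norm_le_norm_limitMap (fun k => (hφ k).norm_le) hu hlower b
    rwa [← hψ, hb, norm_zero, norm_le_zero_iff] at hle
  exact ⟨ψ.codRestrict _ hmem, (StarAlgHom.injective_codRestrict _ _ _).2 hinj⟩

end ApproximateHomomorphisms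

end LimitMap

end CentralSeq

end

theorem theorem3p3 {A : Type*} [CStarAlgebra A] [TopologicalSpace.SeparableSpace A]
    {G : Type*} [Group G] [TopologicalSpace G] [IsTopologicalGroup G] [CompactSpace G] [T2Space G]
    [SecondCountableTopology G]
    (α : G →* (A ≃⋆ₐ[ℂ] A)) (hcont : CentralSeq.StronglyContinuous α)
    (hRok : CentralSeq.HasRokhlinProperty α)
    {B : Type*} [CStarAlgebra B] [TopologicalSpace.SeparableSpace B]
    (hB : CentralSeq.AdmitsCentralSequence B A) :
    ∃ φ : B →⋆ₐ[ℂ] CentralSeq.fixedCentralSeqAlgebra α, Function.Injective φ := by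
  classical
  obtain ⟨Θ, hΘ⟩ := hRok.exists_isRokhlinHom
  obtain ⟨u, hu⟩ := TopologicalSpace.exists_dense_seq B
  obtain ⟨v, hv⟩ := TopologicalSpace.exists_dense_seq A
  choose φ hφ hlower using fun k : ℕ =>
    CentralSeq.exists_isApproxCentralHom hΘ hcont hB ((Finset.range k).image u)
      ((Finset.range k).image v) (u k.unpair.1) (Nat.one_div_pos_of_nat (α := ℝ) (n := k))
  -- Unpairing makes every `u i` the controlled element of infinitely many `φ k`.
  refine CentralSeq.exists_injective_starAlgHom_fixedCentralSeqAlgebra hφ hu hv fun i =>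
    frequently_atTop.2 fun N => ⟨Nat.pair i N, Nat.right_le_pair i N, ?_⟩
  simpa using hlower (Nat.pair i N)
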